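/- Let $L$ be a frame with least element $0$, greatest element $1$ and implication $\to$. An $L$-subset of a set $X$ is a map $A:X\to L$; it is nonempty if $\bigvee_{x}A(x)=1$. Put $\mathrm{sub}(A,B)=\bigwedge_{x}(A(x)\to B(x))$, and, for $f:X\to Y$, $f^{\to}(A)(y)=\bigvee_{f(x)=y}A(x)$. **Spaces.** An $L$-topology on $X$ is a family $\mathcal O(X)\subseteq L^X$ (the open sets) closed under binary meets and arbitrary joins and containing all constant maps $a_X$ ($a\in L$). A map $f$ is continuous if $B\circ f$ is open for every open $B$. Write $A^\circ=\bigvee\{B\in\mathcal O(X): B\le A\}$. A point of $\mathcal O(X)$ is a map $p:\mathcal O(X)\to L$ with $p(A\wedge B)=p(A)\wedge p(B)$, $p(\bigvee_i A_i)=\bigvee_i p(A_i)$ and $p(a_X)=a$ for $a\in L$. The space $X$ is $L$-sober if $x\mapsto[x]$, $[x](A)=A(x)$, is a bijection from $X$ onto the set of points of $\mathcal O(X)$. An $L$-subset $A$ is super-compact if it is nonempty and $\mathrm{sub}(A,\bigvee_i V_i)=\bigvee_i\mathrm{sub}(A,V_i)$ for every family $(V_i)$ of open sets. The space $X$ is locally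 super-compact if $A=\bigvee_{B\text{ super-compact}}\mathrm{sub}(B,A)\wedge B^\circ$ for every open $A$. **Orders.** An $L$-order on $P$ is a map $e:P\times P\to L$ with $e(x,x)=1$, $e(x,y)\wedge e(y,z)\le e(x,z)$, and $x=y$ whenever $e(x,y)\wedge e(y,x)=1$. An element $s$ is the supremum $\sqcup A$ of $A\in L^P$ if $e(s,y)=\bigwedge_x(A(x)\to e(x,y))$ for all $y$. An $L$-subset $D$ is directed if it is nonempty and $D(x)\wedge D(y)\le\bigvee_z D(z)\wedge e(x,z)\wedge e(y,z)$ for all $x,y$. $P$ is an $L$-dcpo if every directed $L$-subset has a supremum. Let $\Downarrow\! x\,(y)=\bigwedge_D\big(e(x,\sqcup D)\to\bigvee_d D(d)\wedge e(y,d)\big)$, where $D$ runs over the directed $L$-subsets that have a supremum. $P$ is continuous if, for every $x$, $\Downarrow\! x$ is directed with supremum $x$. A map $f:P\to Q$ is Scott continuous if, for every directed $D$ with a supremum, $f(\sqcup D)$ is the supremum of $f^{\to}(D)$. An $L$-subset $A$ is Scott open if $A(x)\wedge e(x,y)\le A(y)$ for all $x,y$ and $A(\sqcup D)=\bigvee_x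 A(x)\wedge D(x)$ for every directed $D$ with a supremum. Let $L\text{-}\mathbf{LSCSob}$ be the category of locally super-compact $L$-sober spaces and continuous maps, and $L\text{-}\mathbf{CDom}$ the category of continuous $L$-dcpo's and Scott continuous maps. Let $\Sigma_L$ send a continuous $L$-dcpo $P$ to the set $P$ with the $L$-topology of its Scott open sets, and let $\Omega_L$ send a space $X$ to the set $X$ with the specialization $L$-order $e(x,y)=\bigwedge_{A\in\mathcal O(X)}(A(x)\to A(y))$; both leave the underlying maps of morphisms unchanged. **Theorem.** $\Sigma_L$ and $\Omega_L$ are well-defined functors $L\text{-}\mathbf{CDom}\to L\text{-}\mathbf{LSCSob}$ and $L\text{-}\mathbf{LSCSob}\to L\text{-}\mathbf{CDom}$, and $\Sigma_L\circ\Omega_L=\mathrm{id}$ and $\Omega_L\circ\Sigma_L=\mathrm{id}$. Hence the categories $L\text{-}\mathbf{LSCSob}$ and $L\text{-}\mathbf{CDom}$ are isomorphic. -/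

import Mathlib

universe u v

open CategoryTheory

namespace LDom

/-! ### `L`-subsets -/

/-- The inclusion degree `sub(A, B) = ⋀ₓ A(x) → B(x)` of two `L`-subsets. -/
def sub {L : Type v} [Order.Frame L] {X : Type u} (A B : X → L) : L :=
  ⨅ x, A x ⇨ B x

/-- An `L`-subset is nonempty if the join of its values is `1`. -/
def IsNonempty {L : Type v} [Order.Frame L] {X : Type u} (A : X → L) : Prop :=
  ⨆ x, A x = ⊤

/-- The forward Zadeh extension `f^→(A)(y) = ⋁_{f(x) = y} A(x)`. -/
def zadeh {L : Type v} [Order.Frame L] {X Y : Type u} (f : X → Y) (A : X → L) : Y → L :=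
  fun y => ⨆ (x : X) (_ : f x = y), A x

/-! ### `L`-topological spaces -/

/-- A (stratified) `L`-topology on `X`. -/
@[ext]
structure LTopology (L : Type v) [Order.Frame L] (X : Type u) where
  opens : Set (X → L)
  inf_mem : ∀ A ∈ opens, ∀ B ∈ opens, A ⊓ B ∈ opens
  sSup_mem : ∀ S : Set (X → L), S ⊆ opens → sSup S ∈ opens
  const_mem : ∀ a : L, (fun _ => a) ∈ opens

namespace LTopology

/-- The interior of an `L`-subset: the join of the open sets below it. -/
def interior {L : Type v} [Order.Frame L] {X : Type u} (T : LTopology L X)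
    (A : X → L) : X → L :=
  sSup {B | B ∈ T.opens ∧ B ≤ A}

def IsT0 {L : Type v} [Order.Frame L] {X : Type u} (T : LTopology L X) : Prop :=
  ∀ x y : X, (∀ A ∈ T.opens, A x = A y) → x = y

/-- Super-compact `L`-subsets. -/
def IsSuperCompact {L : Type v} [Order.Frame L] {X : Type u} (T : LTopology L X)
    (A : X → L) : Prop :=
  IsNonempty A ∧ ∀ S : Set (X → L), S ⊆ T.opens → sub A (sSup S) = ⨆ V ∈ S, sub A V

/-- `A = ⋁_{B super-compact} sub(B, A) ∧ B°` for every open `A`. -/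
def IsLocallySuperCompact {L : Type v} [Order.Frame L] {X : Type u}
    (T : LTopology L X) : Prop :=
  ∀ A ∈ T.opens, ∀ x : X,
    A x = ⨆ (B : X → L) (_ : T.IsSuperCompact B), sub B A ⊓ T.interior B x

/-- The points of `𝒪(X)`: maps `p : 𝒪(X) → L` preserving binary meets, arbitrary joins and
constants. -/
structure Point {L : Type v} [Order.Frame L] {X : Type u} (T : LTopology L X) where
  toFun : T.opens → L
  map_inf : ∀ A B : T.opens,
    toFun ⟨A.1 ⊓ B.1, T.inf_mem A.1 A.2 B.1 B.2⟩ = toFun A ⊓ toFun B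
  map_sSup : ∀ (S : Set (X → L)) (hS : S ⊆ T.opens),
    toFun ⟨sSup S, T.sSup_mem S hS⟩ = ⨆ V : S, toFun ⟨V.1, hS V.2⟩
  map_const : ∀ a : L, toFun ⟨fun _ => a, T.const_mem a⟩ = a

/-- The point `[x]` with `[x](A) = A(x)`. -/
def pointOf {L : Type v} [Order.Frame L] {X : Type u} (T : LTopology L X) (x : X) :
    T.Point where
  toFun A := A.1 x
  map_inf _ _ := rfl
  map_sSup S _ := by
    show sSup S x = _
    rw [sSup_apply]
  map_const _ := rfl

/-- `L`-sobriety: `x ↦ [x]` is a bijection from `X` onto the set of points of `𝒪(X)`. -/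
def IsSober {L : Type v} [Order.Frame L] {X : Type u} (T : LTopology L X) : Prop :=
  Function.Bijective T.pointOf

theorem IsSober.isT0 {L : Type v} [Order.Frame L] {X : Type u} {T : LTopology L X}
    (h : T.IsSober) : T.IsT0 := by
  intro x y hxy
  apply h.1
  simp only [pointOf, Point.mk.injEq]
  funext A
  exact hxy A.1 A.2

end LTopology

/-- Continuity of a map between `L`-topological spaces: `B ∘ f` is open for every open `B`. -/
def IsContinuousMap {L : Type v} [Order.Frame L] {X Y : Type u}
    (S : LTopology L X) (T : LTopology L Y) (f : X → Y) : Prop :=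
  ∀ B ∈ T.opens, B ∘ f ∈ S.opens

/-! ### `L`-ordered sets -/

/-- An `L`-order on `P`. -/
@[ext]
structure LOrder (L : Type v) [Order.Frame L] (P : Type u) where
  e : P → P → L
  refl : ∀ x, e x x = ⊤
  trans : ∀ x y z, e x y ⊓ e y z ≤ e x z
  antisymm : ∀ x y, e x y ⊓ e y x = ⊤ → x = y

namespace LOrder

/-- `s` is a supremum of the `L`-subset `A`: `e(s, y) = sub(A, ↓y)` for all `y`. -/
def IsSup {L : Type v} [Order.Frame L] {P : Type u} (E : LOrder L P)
    (A : P → L) (s : P) : Prop :=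
  ∀ y, E.e s y = sub A (fun z => E.e z y)

/-- Directed `L`-subsets. -/
def IsDirected {L : Type v} [Order.Frame L] {P : Type u} (E : LOrder L P)
    (D : P → L) : Prop :=
  IsNonempty D ∧ ∀ x y, D x ⊓ D y ≤ ⨆ z, D z ⊓ E.e x z ⊓ E.e y z

/-- Upper `L`-subsets. -/
def IsUpper {L : Type v} [Order.Frame L] {P : Type u} (E : LOrder L P)
    (A : P → L) : Prop :=
  ∀ x y, A x ⊓ E.e x y ≤ A y

/-- `L`-dcpo's: every directed `L`-subset has a supremum. -/
def IsDcpo {L : Type v} [Order.Frame L] {P : Type u} (E : LOrder L P) : Prop :=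
  ∀ D : P → L, E.IsDirected D → ∃ s, E.IsSup D s

/-- `E.wayBelow x y` is the degree to which `y` is way below `x`: the meet of
`e(x, ⊔D) → ⋁_d D(d) ∧ e(y, d)` over all directed `D` that have a supremum. -/
def wayBelow {L : Type v} [Order.Frame L] {P : Type u} (E : LOrder L P) (x : P) : P → L :=
  fun y => ⨅ (D : P → L) (s : P) (_ : E.IsDirected D) (_ : E.IsSup D s),
    E.e x s ⇨ ⨆ d, D d ⊓ E.e y d

/-- Continuous `L`-ordered sets. -/
def IsContinuous {L : Type v} [Order.Frame L] {P : Type u} (E : LOrder L P) : Prop :=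
  ∀ x, E.IsDirected (E.wayBelow x) ∧ E.IsSup (E.wayBelow x) x

/-- Scott open `L`-subsets. -/
def IsScottOpen {L : Type v} [Order.Frame L] {P : Type u} (E : LOrder L P)
    (A : P → L) : Prop :=
  E.IsUpper A ∧ ∀ (D : P → L) (s : P), E.IsDirected D → E.IsSup D s →
    A s = ⨆ x, A x ⊓ D x

/-- A supremum of `D` is an upper bound of `D`. -/
theorem IsSup.le {L : Type v} [Order.Frame L] {P : Type u} {E : LOrder L P}
    {A : P → L} {s : P} (h : E.IsSup A s) (x : P) : A x ≤ E.e x s := by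
  have h1 := h s
  rw [E.refl] at h1
  have h2 : sub A (fun z => E.e z s) ≤ A x ⇨ E.e x s := iInf_le _ x
  rw [← h1, top_le_iff, himp_eq_top_iff] at h2
  exact h2

/-- The Scott `L`-topology `σ_L(P)`. -/
def scott {L : Type v} [Order.Frame L] {P : Type u} (E : LOrder L P) : LTopology L P where
  opens := {A | E.IsScottOpen A}
  inf_mem := by
    rintro A ⟨hA, hA'⟩ B ⟨hB, hB'⟩
    refine ⟨fun x y => ?_, fun D s hD hs => ?_⟩
    · exact le_inf (le_trans (inf_le_inf_right _ inf_le_left) (hA x y))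
        (le_trans (inf_le_inf_right _ inf_le_right) (hB x y))
    · apply le_antisymm
      · show A s ⊓ B s ≤ _
        rw [hA' D s hD hs, hB' D s hD hs, iSup_inf_iSup]
        refine iSup_le fun p => ?_
        calc A p.1 ⊓ D p.1 ⊓ (B p.2 ⊓ D p.2)
            = A p.1 ⊓ B p.2 ⊓ (D p.1 ⊓ D p.2) := inf_inf_inf_comm _ _ _ _
          _ ≤ A p.1 ⊓ B p.2 ⊓ ⨆ z, D z ⊓ E.e p.1 z ⊓ E.e p.2 z :=
              inf_le_inf_left _ (hD.2 _ _)
          _ ≤ _ := by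
              rw [inf_iSup_eq]
              refine iSup_mono fun z => le_inf (le_inf ?_ ?_) ?_
              · refine le_trans (le_inf ?_ ?_) (hA p.1 z)
                · exact inf_le_left.trans inf_le_left
                · exact inf_le_right.trans (inf_le_left.trans inf_le_right)
              · refine le_trans (le_inf ?_ ?_) (hB p.2 z)
                · exact inf_le_left.trans inf_le_right
                · exact inf_le_right.trans inf_le_right
              · exact inf_le_right.trans (inf_le_left.trans inf_le_left)
      · refine iSup_le fun x => le_inf ?_ ?_
        · exact le_trans (le_inf (inf_le_left.trans inf_le_left)
            (inf_le_right.trans (hs.le x))) (hA x s)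
        · exact le_trans (le_inf (inf_le_left.trans inf_le_right)
            (inf_le_right.trans (hs.le x))) (hB x s)
  sSup_mem := by
    intro S hS
    refine ⟨fun x y => ?_, fun D s hD hs => ?_⟩
    · rw [sSup_apply, sSup_apply, iSup_inf_eq]
      exact iSup_mono fun A => (hS A.2).1 x y
    · simp only [sSup_apply, iSup_inf_eq]
      rw [iSup_comm]
      exact iSup_congr fun A => (hS A.2).2 D s hD hs
  const_mem := by
    intro a
    refine ⟨fun x y => inf_le_left, fun D s hD _ => ?_⟩
    show a = ⨆ x, a ⊓ D x
    rw [← inf_iSup_eq, hD.1, inf_top_eq]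

end LOrder

/-- The specialization `L`-order `e(x, y) = ⋀_{A open} A(x) → A(y)` of a `T₀` space. -/
def LTopology.specOrder {L : Type v} [Order.Frame L] {X : Type u} (T : LTopology L X)
    (h : T.IsT0) : LOrder L X where
  e x y := ⨅ A ∈ T.opens, A x ⇨ A y
  refl x := by simp
  trans x y z := by
    refine le_iInf₂ fun A hA => ?_
    refine le_trans (inf_le_inf (iInf₂_le A hA) (iInf₂_le A hA)) ?_
    rw [le_himp_iff, inf_comm, ← inf_assoc]
    exact (inf_le_inf_right _ inf_himp_le).trans inf_himp_le
  antisymm x y hxy := by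
    rw [inf_eq_top_iff] at hxy
    simp only [iInf_eq_top, himp_eq_top_iff] at hxy
    exact h x y fun A hA => le_antisymm (hxy.1 A hA) (hxy.2 A hA)

/-! ### Scott continuous maps -/

/-- Scott continuity: for every directed `D` with a supremum `s`, the `L`-subset `f^→(D)` has
the supremum `f(s)`. -/
def IsScottContinuous {L : Type v} [Order.Frame L] {P Q : Type u}
    (E : LOrder L P) (F : LOrder L Q) (f : P → Q) : Prop :=
  ∀ (D : P → L) (s : P), E.IsDirected D → E.IsSup D s → F.IsSup (zadeh f D) (f s)

theorem isScottContinuous_id {L : Type v} [Order.Frame L] {P : Type u} (E : LOrder L P) :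
    IsScottContinuous E E id := by
  intro D s _ hs
  have : zadeh id D = D := by
    funext y
    simp [zadeh]
  rw [this]
  exact hs

theorem IsScottContinuous.mono {L : Type v} [Order.Frame L] {P Q : Type u}
    {E : LOrder L P} {F : LOrder L Q} {f : P → Q} (hf : IsScottContinuous E F f) (x y : P) :
    E.e x y ≤ F.e (f x) (f y) := by
  have hdir : E.IsDirected (fun z => E.e z y) := by
    refine ⟨top_le_iff.1 ?_, fun a b => ?_⟩
    · rw [← E.refl y]
      exact le_iSup (fun z => E.e z y) y
    · refine le_trans ?_ (le_iSup _ y)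
      simp [E.refl]
  have hsup : E.IsSup (fun z => E.e z y) y := by
    intro w
    apply le_antisymm
    · refine le_iInf fun z => ?_
      rw [le_himp_iff, inf_comm]
      exact E.trans z y w
    · refine (iInf_le _ y).trans ?_
      simp [E.refl]
  refine le_trans ?_ ((hf _ _ hdir hsup).le (f x))
  exact le_iSup₂_of_le x rfl le_rfl

theorem IsScottContinuous.comp {L : Type v} [Order.Frame L] {P Q R : Type u}
    {E : LOrder L P} {F : LOrder L Q} {G : LOrder L R} {g : Q → R} {f : P → Q}
    (hg : IsScottContinuous F G g) (hf : IsScottContinuous E F f) :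
    IsScottContinuous E G (g ∘ f) := by
  intro D s hD hs
  have hz : zadeh (g ∘ f) D = zadeh g (zadeh f D) := by
    funext r
    apply le_antisymm
    · refine iSup₂_le fun x hx => ?_
      exact le_iSup₂_of_le (f x) hx (le_iSup₂_of_le x rfl le_rfl)
    · refine iSup₂_le fun q hq => iSup₂_le fun x hx => ?_
      exact le_iSup₂_of_le x (by rw [Function.comp_apply, hx, hq]) le_rfl
  have hdir : F.IsDirected (zadeh f D) := by
    refine ⟨top_le_iff.1 ?_, fun a b => ?_⟩
    · rw [← hD.1]
      refine iSup_le fun x => ?_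
      exact le_iSup_of_le (f x) (le_iSup₂_of_le x rfl le_rfl)
    · simp only [zadeh, iSup_inf_eq, inf_iSup_eq]
      refine iSup₂_le fun x hx => iSup₂_le fun y hy => ?_
      subst hx hy
      refine (hD.2 _ _).trans (iSup_le fun z => ?_)
      refine le_iSup_of_le (f z) (le_iSup₂_of_le z rfl ?_)
      exact inf_le_inf (inf_le_inf_left _ (hf.mono _ _)) (hf.mono _ _)
  rw [hz]
  exact hg _ _ hdir (hf D s hD hs)

/-! ### The two categories -/

/-- Locally super-compact `L`-sober spaces. -/
structure LSCSob (L : Type v) [Order.Frame L] where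
  carrier : Type u
  top : LTopology L carrier
  isLocallySuperCompact : top.IsLocallySuperCompact
  isSober : top.IsSober

/-- Continuous maps between locally super-compact `L`-sober spaces. -/
@[ext]
structure LSCSob.Hom {L : Type v} [Order.Frame L] (X Y : LSCSob.{u, v} L) where
  toFun : X.carrier → Y.carrier
  isContinuousMap : IsContinuousMap X.top Y.top toFun

/-- The category `L`-LSCSob. -/
instance LSCSob.category (L : Type v) [Order.Frame L] : Category (LSCSob.{u, v} L) where
  Hom := LSCSob.Hom
  id X := ⟨id, fun _ hB => hB⟩
  comp f g := ⟨g.toFun ∘ f.toFun, fun B hB =>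
    f.isContinuousMap (B ∘ g.toFun) (g.isContinuousMap B hB)⟩

/-- Continuous `L`-dcpo's. -/
structure CDom (L : Type v) [Order.Frame L] where
  carrier : Type u
  ord : LOrder L carrier
  isDcpo : ord.IsDcpo
  isContinuous : ord.IsContinuous

/-- Scott continuous maps between continuous `L`-dcpo's. -/
@[ext]
structure CDom.Hom {L : Type v} [Order.Frame L] (P Q : CDom.{u, v} L) where
  toFun : P.carrier → Q.carrier
  isScottContinuous : IsScottContinuous P.ord Q.ord toFun

/-- The category `L`-CDom. -/
instance CDom.category (L : Type v) [Order.Frame L] : Category (CDom.{u, v} L) where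
  Hom := CDom.Hom
  id P := ⟨id, isScottContinuous_id P.ord⟩
  comp f g := ⟨g.toFun ∘ f.toFun, g.isScottContinuous.comp f.isScottContinuous⟩

/-! ### The two assignments

Each is a functor as soon as it is well defined on objects and on morphisms; these two facts
are passed as arguments and are part of what has to be shown. -/

/-- `Σ_L`: it equips a continuous `L`-dcpo with its Scott `L`-topology and does not change the
underlying maps. -/
def scottFunctor {L : Type v} [Order.Frame L]
    (hobj : ∀ P : CDom.{u, v} L,
      P.ord.scott.IsLocallySuperCompact ∧ P.ord.scott.IsSober)
    (hmap : ∀ (P Q : CDom.{u, v} L) (f : P ⟶ Q),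
      IsContinuousMap P.ord.scott Q.ord.scott f.toFun) :
    CDom.{u, v} L ⥤ LSCSob.{u, v} L where
  obj P := ⟨P.carrier, P.ord.scott, (hobj P).1, (hobj P).2⟩
  map {P Q} f := ⟨f.toFun, hmap P Q f⟩

/-- The specialization `L`-order of a locally super-compact `L`-sober space. -/
def LSCSob.spec {L : Type v} [Order.Frame L] (X : LSCSob.{u, v} L) : LOrder L X.carrier :=
  X.top.specOrder X.isSober.isT0

/-- `Ω_L`: it equips a locally super-compact `L`-sober space with its specialization `L`-order
and does not change the underlying maps. -/
def specFunctor {L : Type v} [Order.Frame L]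
    (hobj : ∀ X : LSCSob.{u, v} L, X.spec.IsDcpo ∧ X.spec.IsContinuous)
    (hmap : ∀ (X Y : LSCSob.{u, v} L) (f : X ⟶ Y),
      IsScottContinuous X.spec Y.spec f.toFun) :
    LSCSob.{u, v} L ⥤ CDom.{u, v} L where
  obj X := ⟨X.carrier, X.spec, (hobj X).1, (hobj X).2⟩
  map {X Y} f := ⟨f.toFun, hmap X Y f⟩

end LDom

/-!
Call a family `U` of open sets indexed by the points a *core base* if every open `A` satisfies
`A x = ⋁_y A y ∧ U y x`. Both kinds of objects are `T₀` spaces with a core base in which every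
directed `L`-subset `D` of the specialization order converges: `A (⊔ D) = ⋁_x A x ∧ D x` for every
open `A`.

For a continuous `L`-dcpo, `U y = {x | y ≪ x}` is a core base of the Scott topology, by
interpolation. For a locally super-compact sober space, a super-compact `B` induces the point
`A ↦ sub(B, A)`, so by sobriety it may be replaced by a principal filter `↑y`, and
`U y = (↑y)°` is a core base.

Conversely, given a core base, `y ↦ U y x` is a directed `L`-subset with supremum `x` lying way
below `x`, which makes the specialization order continuous and its Scott topology the given one;
and a point `p` is determined by the directed `L`-subset `y ↦ p (U y)`, whose supremum represents
it, which gives sobriety.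
-/

namespace LDom

variable {L : Type v} [Order.Frame L]

section Subset

variable {X Y : Type u}

theorem inf_sub_le (A B : X → L) (x : X) : A x ⊓ sub A B ≤ B x :=
  (inf_le_inf_left _ (iInf_le _ x)).trans inf_himp_le

theorem le_sub_iff {A B : X → L} {a : L} : a ≤ sub A B ↔ ∀ x, A x ⊓ a ≤ B x := by
  simp only [sub, le_iInf_iff, le_himp_iff']

theorem iSup_inf_zadeh (f : X → Y) (B : Y → L) (D : X → L) :
    ⨆ y, B y ⊓ zadeh f D y = ⨆ x, B (f x) ⊓ D x := by
  simp only [zadeh, inf_iSup_eq]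
  rw [iSup_comm]
  exact iSup_congr fun x => iSup_iSup_eq_right

/-- The union of the `L`-subsets `F z`, where `z` ranges over the `L`-subset `D`. -/
def weightedUnion (D : X → L) (F : X → Y → L) : Y → L :=
  fun y => ⨆ z, F z y ⊓ D z

end Subset

namespace LOrder

variable {P Q : Type u} {E : LOrder L P} {F : LOrder L Q}

/-! ### Directed `L`-subsets and suprema -/

theorem isDirected_principal (E : LOrder L P) (x : P) : E.IsDirected fun y => E.e y x := by
  refine ⟨top_le_iff.1 ((E.refl x).ge.trans (le_iSup (E.e · x) x)), fun a b => ?_⟩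
  exact le_iSup_of_le x (by simp only [E.refl, top_inf_eq, le_refl])

theorem isSup_principal (E : LOrder L P) (x : P) : E.IsSup (fun y => E.e y x) x := fun w =>
  le_antisymm (le_sub_iff.2 fun y => E.trans y x w)
    (by simpa only [E.refl, top_inf_eq] using inf_sub_le (E.e · x) (E.e · w) x)

theorem IsSup.unique {A : P → L} {s t : P} (hs : E.IsSup A s) (ht : E.IsSup A t) : s = t := by
  have hst : E.e s t = ⊤ := ((hs t).trans (ht t).symm).trans (E.refl t)
  have hts : E.e t s = ⊤ := ((ht s).trans (hs s).symm).trans (E.refl s)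
  exact E.antisymm s t (by rw [hst, hts, inf_top_eq])

theorem IsDirected.iSup_inf_inf {D : P → L} (hD : E.IsDirected D) {A B : P → L}
    (hA : E.IsUpper A) (hB : E.IsUpper B) :
    ⨆ x, A x ⊓ B x ⊓ D x = (⨆ x, A x ⊓ D x) ⊓ ⨆ x, B x ⊓ D x := by
  have move_up (x y z : P) : A x ⊓ B y ⊓ (D z ⊓ E.e x z ⊓ E.e y z) ≤ A z ⊓ B z ⊓ D z :=
    calc A x ⊓ B y ⊓ (D z ⊓ E.e x z ⊓ E.e y z)
        = (A x ⊓ E.e x z) ⊓ (B y ⊓ E.e y z) ⊓ D z := by ac_rfl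
      _ ≤ A z ⊓ B z ⊓ D z := inf_le_inf_right _ (inf_le_inf (hA x z) (hB y z))
  apply le_antisymm
  · exact le_inf (iSup_mono fun x => inf_le_inf_right _ inf_le_left)
      (iSup_mono fun x => inf_le_inf_right _ inf_le_right)
  · rw [iSup_inf_iSup]
    refine iSup_le fun ⟨x, y⟩ => ?_
    calc A x ⊓ D x ⊓ (B y ⊓ D y)
        = A x ⊓ B y ⊓ (D x ⊓ D y) := inf_inf_inf_comm _ _ _ _
      _ ≤ A x ⊓ B y ⊓ ⨆ z, D z ⊓ E.e x z ⊓ E.e y z := inf_le_inf_left _ (hD.2 x y)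
      _ ≤ ⨆ z, A z ⊓ B z ⊓ D z := by
          rw [inf_iSup_eq]
          exact iSup_mono (move_up x y)

theorem IsDirected.zadeh {D : P → L} (hD : E.IsDirected D) {f : P → Q}
    (hf : ∀ x y, E.e x y ≤ F.e (f x) (f y)) : F.IsDirected (zadeh f D) := by
  have le_zadeh (x : P) : D x ≤ LDom.zadeh f D (f x) := le_iSup₂_of_le x rfl le_rfl
  refine ⟨top_le_iff.1 (hD.1.ge.trans (iSup_le fun x => le_iSup_of_le _ (le_zadeh x))),
    fun a b => ?_⟩
  refine le_himp_iff.1 (iSup₂_le fun x hx =>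
    le_himp_comm.1 (iSup₂_le fun y hy => le_himp_iff'.2 ?_))
  subst hx hy
  exact (hD.2 _ _).trans (iSup_le fun z => le_iSup_of_le (f z)
    (inf_le_inf (inf_le_inf (le_zadeh z) (hf _ z)) (hf _ z)))

theorem IsDirected.weightedUnion {D : P → L} (hD : E.IsDirected D) {F : P → P → L}
    (hF : ∀ z, E.IsDirected (F z)) (hup : ∀ y, E.IsUpper fun z => F z y) :
    E.IsDirected (weightedUnion D F) := by
  constructor
  · calc ⨆ y, ⨆ z, F z y ⊓ D z
        = ⨆ z, (⨆ y, F z y) ⊓ D z := by simp only [iSup_inf_eq]; exact iSup_comm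
      _ = ⨆ z, D z := iSup_congr fun z => by rw [(hF z).1, top_inf_eq]
      _ = ⊤ := hD.1
  · intro a b
    calc (⨆ z, F z a ⊓ D z) ⊓ ⨆ z, F z b ⊓ D z
        = ⨆ z, F z a ⊓ F z b ⊓ D z := (hD.iSup_inf_inf (hup a) (hup b)).symm
      _ ≤ ⨆ z, (⨆ c, F z c ⊓ E.e a c ⊓ E.e b c) ⊓ D z :=
          iSup_mono fun z => inf_le_inf_right _ ((hF z).2 a b)
      _ = ⨆ c, (⨆ z, F z c ⊓ D z) ⊓ E.e a c ⊓ E.e b c := by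
          simp only [iSup_inf_eq]
          rw [iSup_comm]
          exact iSup_congr fun c => iSup_congr fun z => by ac_rfl

theorem IsSup.weightedUnion {D : P → L} {x : P} (hx : E.IsSup D x) {F : P → P → L}
    (hF : ∀ z, E.IsSup (F z) z) : E.IsSup (weightedUnion D F) x := by
  refine fun y => eq_of_forall_le_iff fun a => ?_
  calc a ≤ E.e x y
      ↔ ∀ z, D z ⊓ a ≤ E.e z y := by rw [hx y, le_sub_iff]
    _ ↔ ∀ z w, F z w ⊓ (D z ⊓ a) ≤ E.e w y :=
        forall_congr' fun z => by rw [hF z y, le_sub_iff]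
    _ ↔ ∀ w, (⨆ z, F z w ⊓ D z) ⊓ a ≤ E.e w y := by
        rw [forall_comm]
        simp only [iSup_inf_eq, iSup_le_iff, inf_assoc]
    _ ↔ a ≤ sub (LDom.weightedUnion D F) fun w => E.e w y := le_sub_iff.symm

/-! ### The way below relation -/

theorem le_wayBelow_iff {x y : P} {a : L} :
    a ≤ E.wayBelow x y ↔
      ∀ D s, E.IsDirected D → E.IsSup D s → a ⊓ E.e x s ≤ ⨆ d, D d ⊓ E.e y d := by
  simp only [wayBelow, le_iInf_iff, le_himp_iff]

theorem wayBelow_le_iSup (E : LOrder L P) {D : P → L} {s : P} (hD : E.IsDirected D)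
    (hs : E.IsSup D s) (y : P) : E.wayBelow s y ≤ ⨆ d, D d ⊓ E.e y d := by
  simpa only [E.refl, inf_top_eq] using le_wayBelow_iff.1 (le_refl (E.wayBelow s y)) D s hD hs

theorem wayBelow_le (E : LOrder L P) (x y : P) : E.wayBelow x y ≤ E.e y x :=
  calc E.wayBelow x y
      ≤ ⨆ z, E.e z x ⊓ E.e y z :=
        E.wayBelow_le_iSup (E.isDirected_principal x) (E.isSup_principal x) y
    _ ≤ E.e y x := iSup_le fun z => inf_comm (E.e z x) _ ▸ E.trans y z x

theorem isUpper_wayBelow (E : LOrder L P) (y : P) : E.IsUpper fun x => E.wayBelow x y :=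
  fun x x' => le_wayBelow_iff.2 fun D s hD hs =>
    calc E.wayBelow x y ⊓ E.e x x' ⊓ E.e x' s
        ≤ E.wayBelow x y ⊓ E.e x s := by
          rw [inf_assoc]
          exact inf_le_inf_left _ (E.trans x x' s)
      _ ≤ ⨆ d, D d ⊓ E.e y d := le_wayBelow_iff.1 le_rfl D s hD hs

theorem wayBelow_inf_le (E : LOrder L P) (x y z : P) :
    E.wayBelow x z ⊓ E.e y z ≤ E.wayBelow x y := by
  refine le_wayBelow_iff.2 fun D s hD hs => ?_
  calc E.wayBelow x z ⊓ E.e y z ⊓ E.e x s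
      = E.e y z ⊓ (E.wayBelow x z ⊓ E.e x s) := by ac_rfl
    _ ≤ E.e y z ⊓ ⨆ d, D d ⊓ E.e z d :=
        inf_le_inf_left _ (le_wayBelow_iff.1 le_rfl D s hD hs)
    _ ≤ ⨆ d, D d ⊓ E.e y d := by
        rw [inf_iSup_eq]
        refine iSup_mono fun d => ?_
        rw [inf_left_comm]
        exact inf_le_inf_left _ (E.trans y z d)

theorem IsScottOpen.le_wayBelow {A : P → L} (hA : E.IsScottOpen A) {y : P} (hy : A ≤ E.e y)
    (x : P) : A x ≤ E.wayBelow x y :=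
  le_wayBelow_iff.2 fun D s hD hs =>
    calc A x ⊓ E.e x s
        ≤ A s := hA.1 x s
      _ = ⨆ d, A d ⊓ D d := hA.2 D s hD hs
      _ ≤ ⨆ d, D d ⊓ E.e y d := iSup_mono fun d =>
          inf_comm (D d) _ ▸ inf_le_inf_left _ (hy d)

theorem IsDirected.isDirected_wayBelow {D : P → L} {x : P} (hD : E.IsDirected D)
    (hx : E.IsSup D x) (hle : D ≤ E.wayBelow x) : E.IsDirected (E.wayBelow x) := by
  refine ⟨top_le_iff.1 (hD.1.ge.trans (iSup_mono hle)), fun a b => ?_⟩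
  have le_iSup_inf (c : P) : E.wayBelow x c ≤ ⨆ d, E.e c d ⊓ D d := by
    simpa only [inf_comm] using E.wayBelow_le_iSup hD hx c
  calc E.wayBelow x a ⊓ E.wayBelow x b
      ≤ (⨆ z, E.e a z ⊓ D z) ⊓ ⨆ z, E.e b z ⊓ D z := inf_le_inf (le_iSup_inf a) (le_iSup_inf b)
    _ = ⨆ z, E.e a z ⊓ E.e b z ⊓ D z := (hD.iSup_inf_inf (E.trans a) (E.trans b)).symm
    _ ≤ ⨆ z, E.wayBelow x z ⊓ E.e a z ⊓ E.e b z := iSup_mono fun z => by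
        rw [inf_comm, ← inf_assoc]
        exact inf_le_inf_right _ (inf_le_inf_right _ (hle z))

theorem IsSup.isSup_wayBelow {D : P → L} {x : P} (hx : E.IsSup D x) (hle : D ≤ E.wayBelow x) :
    E.IsSup (E.wayBelow x) x := by
  refine fun y => le_antisymm (le_sub_iff.2 fun z => ?_) ?_
  · exact (inf_le_inf_right _ (E.wayBelow_le x z)).trans (E.trans z x y)
  · rw [hx y]
    exact le_sub_iff.2 fun z => (inf_le_inf_right _ (hle z)).trans (inf_sub_le _ _ z)

theorem IsContinuous.wayBelow_le_weightedUnion (hE : E.IsContinuous) (x : P) :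
    E.wayBelow x ≤ weightedUnion (E.wayBelow x) E.wayBelow := by
  have hdir : E.IsDirected (weightedUnion (E.wayBelow x) E.wayBelow) :=
    (hE x).1.weightedUnion (fun z => (hE z).1) E.isUpper_wayBelow
  have hsup : E.IsSup (weightedUnion (E.wayBelow x) E.wayBelow) x :=
    (hE x).2.weightedUnion fun z => (hE z).2
  refine fun y => (E.wayBelow_le_iSup hdir hsup y).trans (iSup_le fun d => ?_)
  simp only [weightedUnion, iSup_inf_eq]
  refine iSup_mono fun z => ?_
  rw [inf_right_comm]
  exact inf_le_inf_right _ (E.wayBelow_inf_le z y d)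

theorem IsContinuous.isScottOpen_wayBelow (hE : E.IsContinuous) (y : P) :
    E.IsScottOpen fun x => E.wayBelow x y := by
  refine ⟨E.isUpper_wayBelow y, fun D s hD hs => le_antisymm ?_ ?_⟩
  · calc E.wayBelow s y
        ≤ ⨆ z, E.wayBelow z y ⊓ E.wayBelow s z := hE.wayBelow_le_weightedUnion s y
      _ ≤ ⨆ z, E.wayBelow z y ⊓ ⨆ d, D d ⊓ E.e z d :=
          iSup_mono fun z => inf_le_inf_left _ (E.wayBelow_le_iSup hD hs z)
      _ = ⨆ d, ⨆ z, E.wayBelow z y ⊓ E.e z d ⊓ D d := by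
          simp only [inf_iSup_eq]
          rw [iSup_comm]
          exact iSup_congr fun d => iSup_congr fun z => by ac_rfl
      _ ≤ ⨆ d, E.wayBelow d y ⊓ D d :=
          iSup_mono fun d => iSup_le fun z => inf_le_inf_right _ (E.isUpper_wayBelow y z d)
  · exact iSup_le fun x => (inf_le_inf_left _ (hs.le x)).trans (E.isUpper_wayBelow y x s)

theorem IsContinuous.isT0_scott (hE : E.IsContinuous) : E.scott.IsT0 := fun x y hxy =>
  have h : E.wayBelow x = E.wayBelow y := funext fun z => hxy _ (hE.isScottOpen_wayBelow z)
  (hE x).2.unique (h ▸ (hE y).2)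

theorem IsContinuous.specOrder_scott (hE : E.IsContinuous) (h : E.scott.IsT0) :
    E.scott.specOrder h = E := by
  ext x y
  apply le_antisymm
  · rw [(hE x).2 y]
    refine le_iInf fun z => ?_
    calc ⨅ A ∈ E.scott.opens, A x ⇨ A y
        ≤ E.wayBelow x z ⇨ E.wayBelow y z :=
          iInf₂_le (fun x => E.wayBelow x z) (hE.isScottOpen_wayBelow z)
      _ ≤ E.wayBelow x z ⇨ E.e z y := himp_le_himp_left (E.wayBelow_le y z)
  · exact le_iInf₂ fun A hA => le_himp_iff'.2 (hA.1 x y)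

end LOrder

namespace LTopology

variable {X : Type u} {T : LTopology L X}

/-! ### Open sets and points -/

theorem interior_le (T : LTopology L X) (A : X → L) : T.interior A ≤ A :=
  sSup_le fun _ hB => hB.2

theorem interior_mem_opens (T : LTopology L X) (A : X → L) : T.interior A ∈ T.opens :=
  T.sSup_mem _ fun _ hB => hB.1

theorem le_interior {A B : X → L} (hB : B ∈ T.opens) (h : B ≤ A) : B ≤ T.interior A :=
  le_sSup ⟨hB, h⟩

theorem const_inf_mem_opens {A : X → L} (hA : A ∈ T.opens) (a : L) :
    (fun x => a ⊓ A x) ∈ T.opens :=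
  T.inf_mem _ (T.const_mem a) _ hA

theorem iSup_mem_opens {ι : Sort*} {A : ι → X → L} (hA : ∀ i, A i ∈ T.opens) :
    (⨆ i, A i) ∈ T.opens :=
  T.sSup_mem _ (Set.range_subset_iff.2 hA)

attribute [ext] Point

theorem Point.map_const_inf (p : T.Point) (a : L) {A : X → L} (hA : A ∈ T.opens) :
    p.toFun ⟨fun x => a ⊓ A x, const_inf_mem_opens hA a⟩ = a ⊓ p.toFun ⟨A, hA⟩ :=
  (p.map_inf ⟨_, T.const_mem a⟩ ⟨A, hA⟩).trans (by rw [p.map_const])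

theorem Point.map_iSup (p : T.Point) {ι : Sort*} {A : ι → X → L} (hA : ∀ i, A i ∈ T.opens) :
    p.toFun ⟨⨆ i, A i, iSup_mem_opens hA⟩ = ⨆ i, p.toFun ⟨A i, hA i⟩ :=
  (p.map_sSup (Set.range A) (Set.range_subset_iff.2 hA)).trans
    (Set.rangeFactorization_surjective.iSup_comp _).symm

theorem IsT0.pointOf_injective (h : T.IsT0) : Function.Injective T.pointOf := fun x y hxy =>
  h x y fun A hA => congrArg (fun p : T.Point => p.toFun ⟨A, hA⟩) hxy

theorem exists_apply_eq_of_surjective (hT : Function.Surjective T.pointOf) (p : T.Point) :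
    ∃ s, ∀ A (hA : A ∈ T.opens), A s = p.toFun ⟨A, hA⟩ := by
  obtain ⟨s, rfl⟩ := hT p
  exact ⟨s, fun _ _ => rfl⟩

/-- The point `A ↦ ⋁ₓ A(x) ∧ D(x)`, to which a directed `L`-subset `D` converges when all open
sets are upper. -/
def pointOfDirected {E : LOrder L X} (hT : ∀ A ∈ T.opens, E.IsUpper A) {D : X → L}
    (hD : E.IsDirected D) : T.Point where
  toFun A := ⨆ x, A.1 x ⊓ D x
  map_inf A B := hD.iSup_inf_inf (hT A.1 A.2) (hT B.1 B.2)
  map_sSup S hS := by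
    simp only [sSup_apply, iSup_inf_eq]
    exact iSup_comm
  map_const a := by rw [← inf_iSup_eq, hD.1, inf_top_eq]

/-- The point `A ↦ sub(B, A)` given by a super-compact `L`-subset `B`. -/
def IsSuperCompact.point {B : X → L} (hB : T.IsSuperCompact B) : T.Point where
  toFun A := sub B A.1
  map_inf A A' := by simp only [sub, Pi.inf_apply, himp_inf_distrib, iInf_inf_eq]
  map_sSup S hS := by rw [hB.2 S hS, iSup_subtype]
  map_const a := by rw [sub, ← iSup_himp_eq, hB.1, top_himp]

/-! ### The specialization order -/

/-- The degree `⋀_{A open} A(x) → A(y)` to which `y` specializes `x`, for a space that need not be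
`T₀`; `T.specDegree x` is the principal filter `↑x`. -/
def specDegree (T : LTopology L X) (x y : X) : L :=
  ⨅ A ∈ T.opens, A x ⇨ A y

theorem le_specDegree_iff {x y : X} {a : L} :
    a ≤ T.specDegree x y ↔ ∀ A ∈ T.opens, A x ⊓ a ≤ A y := by
  simp only [specDegree, le_iInf_iff, le_himp_iff']

theorem apply_inf_specDegree_le {A : X → L} (hA : A ∈ T.opens) (x y : X) :
    A x ⊓ T.specDegree x y ≤ A y :=
  le_specDegree_iff.1 le_rfl A hA

theorem specDegree_self (T : LTopology L X) (x : X) : T.specDegree x x = ⊤ :=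
  top_le_iff.1 (le_specDegree_iff.2 fun _ _ => inf_le_left)

theorem sub_specDegree {A : X → L} (hA : A ∈ T.opens) (x : X) :
    sub (T.specDegree x) A = A x := by
  apply le_antisymm
  · simpa only [specDegree_self, top_inf_eq] using inf_sub_le (T.specDegree x) A x
  · exact le_sub_iff.2 fun y => inf_comm (A x) _ ▸ apply_inf_specDegree_le hA x y

theorem isSuperCompact_specDegree (T : LTopology L X) (x : X) :
    T.IsSuperCompact (T.specDegree x) := by
  refine ⟨top_le_iff.1 ((T.specDegree_self x).ge.trans (le_iSup (T.specDegree x) x)),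
    fun S hS => ?_⟩
  rw [sub_specDegree (T.sSup_mem S hS), sSup_apply, iSup_subtype]
  exact iSup_congr fun V => iSup_congr fun hV => (sub_specDegree (hS hV) x).symm

theorem isUpper_specOrder (h : T.IsT0) {A : X → L} (hA : A ∈ T.opens) :
    (T.specOrder h).IsUpper A :=
  apply_inf_specDegree_le hA

theorem isSup_specOrder (h : T.IsT0) {D : X → L} {s : X}
    (hs : ∀ A ∈ T.opens, A s = ⨆ x, A x ⊓ D x) : (T.specOrder h).IsSup D s := by
  refine fun y => eq_of_forall_le_iff fun a => ?_
  calc a ≤ T.specDegree s y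
      ↔ ∀ A ∈ T.opens, (⨆ x, A x ⊓ D x) ⊓ a ≤ A y := by
        rw [le_specDegree_iff]
        exact forall₂_congr fun A hA => by rw [hs A hA]
    _ ↔ ∀ x, ∀ A ∈ T.opens, A x ⊓ (D x ⊓ a) ≤ A y := by
        simp only [iSup_inf_eq, iSup_le_iff, inf_assoc]
        exact ⟨fun H x A hA => H A hA x, fun H A hA x => H x A hA⟩
    _ ↔ ∀ x, D x ⊓ a ≤ T.specDegree x y := by simp only [le_specDegree_iff]
    _ ↔ a ≤ sub D fun x => T.specDegree x y := le_sub_iff.symm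

theorem IsSober.exists_forall_apply_eq_iSup (hT : T.IsSober) {D : X → L}
    (hD : (T.specOrder hT.isT0).IsDirected D) : ∃ s, ∀ A ∈ T.opens, A s = ⨆ x, A x ⊓ D x :=
  exists_apply_eq_of_surjective hT.2
    (pointOfDirected (fun _ => isUpper_specOrder hT.isT0) hD)

theorem IsSober.isDcpo_specOrder (hT : T.IsSober) : (T.specOrder hT.isT0).IsDcpo := fun _ hD =>
  (hT.exists_forall_apply_eq_iSup hD).imp fun _ => isSup_specOrder hT.isT0

theorem IsSober.opens_subset_scott (hT : T.IsSober) :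
    T.opens ⊆ (T.specOrder hT.isT0).scott.opens := by
  refine fun A hA => ⟨isUpper_specOrder hT.isT0 hA, fun D s hD hs => ?_⟩
  obtain ⟨t, ht⟩ := hT.exists_forall_apply_eq_iSup hD
  rw [hs.unique (isSup_specOrder hT.isT0 ht), ht A hA]

/-! ### Core bases -/

/-- A base of open sets `U y`, each contained in the principal filter `↑y`, from which every open
set is recovered by its values at the indices. The inclusion `U y ≤ ↑y` is the inequality
`A y ∧ U y x ≤ A x` contained in `apply_eq_iSup`. Classically, the spaces with a core base are
Erné's C-spaces. -/
structure IsCoreBase (T : LTopology L X) (U : X → X → L) : Prop where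
  mem_opens : ∀ y, U y ∈ T.opens
  apply_eq_iSup : ∀ A ∈ T.opens, ∀ x, A x = ⨆ y, A y ⊓ U y x

namespace IsCoreBase

variable {U : X → X → L}

theorem le_specDegree (hU : T.IsCoreBase U) (y : X) : U y ≤ T.specDegree y := fun x =>
  le_specDegree_iff.2 fun A hA =>
    (le_iSup (fun y => A y ⊓ U y x) y).trans (hU.apply_eq_iSup A hA x).ge

theorem isLocallySuperCompact (hU : T.IsCoreBase U) : T.IsLocallySuperCompact := by
  intro A hA x
  apply le_antisymm
  · rw [hU.apply_eq_iSup A hA x]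
    refine iSup_le fun y =>
      le_iSup₂_of_le (T.specDegree y) (T.isSuperCompact_specDegree y) ?_
    rw [sub_specDegree hA]
    exact inf_le_inf_left _ (le_interior (hU.mem_opens y) (hU.le_specDegree y) x)
  · refine iSup₂_le fun B _ => ?_
    calc sub B A ⊓ T.interior B x
        ≤ sub B A ⊓ B x := inf_le_inf_left _ (T.interior_le B x)
      _ ≤ A x := inf_comm (B x) _ ▸ inf_sub_le B A x

theorem point_apply_eq_iSup (hU : T.IsCoreBase U) (p : T.Point) {A : X → L}
    (hA : A ∈ T.opens) :
    p.toFun ⟨A, hA⟩ = ⨆ y, A y ⊓ p.toFun ⟨U y, hU.mem_opens y⟩ := by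
  have hAU (y : X) : (fun x => A y ⊓ U y x) ∈ T.opens :=
    const_inf_mem_opens (hU.mem_opens y) (A y)
  have hA_eq : A = ⨆ y, fun x => A y ⊓ U y x := funext fun x => by
    rw [hU.apply_eq_iSup A hA x, iSup_apply]
  rw [show (⟨A, hA⟩ : T.opens) = ⟨_, iSup_mem_opens hAU⟩ from Subtype.ext hA_eq, p.map_iSup hAU]
  exact iSup_congr fun y => p.map_const_inf (A y) (hU.mem_opens y)

theorem isDirected_point (hU : T.IsCoreBase U) (h : T.IsT0) (p : T.Point) :
    (T.specOrder h).IsDirected fun y => p.toFun ⟨U y, hU.mem_opens y⟩ := by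
  constructor
  · calc ⨆ y, p.toFun ⟨U y, hU.mem_opens y⟩
        = ⨆ y, ⊤ ⊓ p.toFun ⟨U y, hU.mem_opens y⟩ := by simp only [top_inf_eq]
      _ = ⊤ := (hU.point_apply_eq_iSup p (T.const_mem ⊤)).symm.trans (p.map_const ⊤)
  · intro a b
    calc p.toFun ⟨U a, hU.mem_opens a⟩ ⊓ p.toFun ⟨U b, hU.mem_opens b⟩
        = p.toFun ⟨U a ⊓ U b, T.inf_mem _ (hU.mem_opens a) _ (hU.mem_opens b)⟩ :=
          (p.map_inf _ _).symm
      _ = ⨆ y, U a y ⊓ U b y ⊓ p.toFun ⟨U y, hU.mem_opens y⟩ := hU.point_apply_eq_iSup p _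
      _ ≤ ⨆ y, p.toFun ⟨U y, hU.mem_opens y⟩ ⊓ T.specDegree a y ⊓ T.specDegree b y :=
          iSup_mono fun y => by
            rw [inf_comm, ← inf_assoc]
            exact inf_le_inf (inf_le_inf_left _ (hU.le_specDegree a y)) (hU.le_specDegree b y)

theorem isDirected_apply (hU : T.IsCoreBase U) (h : T.IsT0) (x : X) :
    (T.specOrder h).IsDirected fun y => U y x :=
  hU.isDirected_point h (T.pointOf x)

theorem isSup_apply (hU : T.IsCoreBase U) (h : T.IsT0) (x : X) :
    (T.specOrder h).IsSup (fun y => U y x) x :=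
  isSup_specOrder h fun A hA => hU.apply_eq_iSup A hA x

theorem isSober (hU : T.IsCoreBase U) (h : T.IsT0) (hd : (T.specOrder h).IsDcpo)
    (hT : T.opens ⊆ (T.specOrder h).scott.opens) : T.IsSober := by
  refine ⟨h.pointOf_injective, fun p => ?_⟩
  have hD := hU.isDirected_point h p
  obtain ⟨s, hs⟩ := hd _ hD
  refine ⟨s, Point.ext (funext fun A => ?_)⟩
  calc A.1 s
      = ⨆ y, A.1 y ⊓ p.toFun ⟨U y, hU.mem_opens y⟩ := (hT A.2).2 _ s hD hs
    _ = p.toFun A := (hU.point_apply_eq_iSup p A.2).symm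

theorem isContinuous_specOrder (hU : T.IsCoreBase U) (h : T.IsT0)
    (hT : T.opens ⊆ (T.specOrder h).scott.opens) : (T.specOrder h).IsContinuous := by
  intro x
  have hle : (fun y => U y x) ≤ (T.specOrder h).wayBelow x := fun y =>
    LOrder.IsScottOpen.le_wayBelow (hT (hU.mem_opens y)) (hU.le_specDegree y) x
  exact ⟨(hU.isDirected_apply h x).isDirected_wayBelow (hU.isSup_apply h x) hle,
    (hU.isSup_apply h x).isSup_wayBelow hle⟩

theorem scott_specOrder (hU : T.IsCoreBase U) (h : T.IsT0)
    (hT : T.opens ⊆ (T.specOrder h).scott.opens) : (T.specOrder h).scott = T := by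
  refine LTopology.ext (Set.Subset.antisymm (fun A hA => ?_) hT)
  have hA_eq : A = ⨆ y, fun x => A y ⊓ U y x := funext fun x => by
    rw [hA.2 _ x (hU.isDirected_apply h x) (hU.isSup_apply h x), iSup_apply]
  rw [hA_eq]
  exact iSup_mem_opens fun y => const_inf_mem_opens (hU.mem_opens y) (A y)

end IsCoreBase

theorem IsLocallySuperCompact.isCoreBase_interior (hl : T.IsLocallySuperCompact)
    (hT : Function.Surjective T.pointOf) :
    T.IsCoreBase fun y => T.interior (T.specDegree y) := by
  refine ⟨fun y => T.interior_mem_opens _, fun A hA x => le_antisymm ?_ ?_⟩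
  · rw [hl A hA x]
    refine iSup₂_le fun B hB => ?_
    obtain ⟨y, hy⟩ : ∃ y, ∀ C ∈ T.opens, C y = sub B C :=
      exists_apply_eq_of_surjective hT hB.point
    have hBy : B ≤ T.specDegree y := fun z => le_specDegree_iff.2 fun C hC => by
      rw [hy C hC, inf_comm]
      exact inf_sub_le B C z
    have hint : T.interior B ≤ T.interior (T.specDegree y) :=
      le_interior (T.interior_mem_opens B) ((T.interior_le B).trans hBy)
    exact le_iSup_of_le y (inf_le_inf (hy A hA).ge (hint x))
  · exact iSup_le fun y => (inf_le_inf_left _ (T.interior_le _ x)).trans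
      (apply_inf_specDegree_le hA y x)

end LTopology

namespace LOrder.IsContinuous

variable {P : Type u} {E : LOrder L P}

theorem isCoreBase_wayBelow (hE : E.IsContinuous) :
    E.scott.IsCoreBase fun y x => E.wayBelow x y :=
  ⟨hE.isScottOpen_wayBelow, fun _ hA x => hA.2 _ x (hE x).1 (hE x).2⟩

theorem isSober_scott (hE : E.IsContinuous) (hd : E.IsDcpo) : E.scott.IsSober := by
  have hspec := hE.specOrder_scott hE.isT0_scott
  exact hE.isCoreBase_wayBelow.isSober hE.isT0_scott (by rwa [hspec]) (by rw [hspec])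

end LOrder.IsContinuous

/-! ### Morphisms -/

section Maps

variable {X Y : Type u} {E : LOrder L X} {f : X → Y}

theorem IsScottContinuous.isContinuousMap {F : LOrder L Y} (hf : IsScottContinuous E F f) :
    IsContinuousMap E.scott F.scott f := fun B hB =>
  ⟨fun x y => (inf_le_inf_left _ (hf.mono x y)).trans (hB.1 _ _), fun D s hD hs =>
    (hB.2 _ _ (hD.zadeh hf.mono) (hf D s hD hs)).trans (iSup_inf_zadeh f B D)⟩

theorem IsContinuousMap.isScottContinuous {T : LTopology L Y} (hf : IsContinuousMap E.scott T f)
    (h : T.IsT0) : IsScottContinuous E (T.specOrder h) f := fun D s hD hs =>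
  LTopology.isSup_specOrder h fun A hA =>
    ((hf A hA).2 D s hD hs).trans (iSup_inf_zadeh f A D).symm

end Maps

attribute [ext] LSCSob CDom

namespace LSCSob

theorem isContinuous_spec (X : LSCSob.{u, v} L) : X.spec.IsContinuous :=
  (X.isLocallySuperCompact.isCoreBase_interior X.isSober.2).isContinuous_specOrder
    X.isSober.isT0 X.isSober.opens_subset_scott

theorem scott_spec (X : LSCSob.{u, v} L) : X.spec.scott = X.top :=
  (X.isLocallySuperCompact.isCoreBase_interior X.isSober.2).scott_specOrder
    X.isSober.isT0 X.isSober.opens_subset_scott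

theorem Hom.heq_of_toFun {X Y X' Y' : LSCSob.{u, v} L} (hX : X = X') (hY : Y = Y')
    {f : X ⟶ Y} {g : X' ⟶ Y'} (h : HEq f.toFun g.toFun) : HEq f g := by
  subst hX hY
  exact heq_of_eq (Hom.ext (eq_of_heq h))

end LSCSob

namespace CDom

theorem Hom.heq_of_toFun {P Q P' Q' : CDom.{u, v} L} (hP : P = P') (hQ : Q = Q')
    {f : P ⟶ Q} {g : P' ⟶ Q'} (h : HEq f.toFun g.toFun) : HEq f g := by
  subst hP hQ
  exact heq_of_eq (Hom.ext (eq_of_heq h))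

end CDom

section Functors

variable
  (hScott : ∀ P : CDom.{u, v} L, P.ord.scott.IsLocallySuperCompact ∧ P.ord.scott.IsSober)
  (hScottMap : ∀ (P Q : CDom.{u, v} L) (f : P ⟶ Q),
    IsContinuousMap P.ord.scott Q.ord.scott f.toFun)
  (hSpec : ∀ X : LSCSob.{u, v} L, X.spec.IsDcpo ∧ X.spec.IsContinuous)
  (hSpecMap : ∀ (X Y : LSCSob.{u, v} L) (f : X ⟶ Y), IsScottContinuous X.spec Y.spec f.toFun)

theorem specFunctor_comp_scottFunctor :
    specFunctor hSpec hSpecMap ⋙ scottFunctor hScott hScottMap = 𝟭 (LSCSob.{u, v} L) :=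
  have hobj (X : LSCSob.{u, v} L) :
      (specFunctor hSpec hSpecMap ⋙ scottFunctor hScott hScottMap).obj X = X :=
    LSCSob.ext rfl (heq_of_eq X.scott_spec)
  Functor.hext hobj fun X Y _ => LSCSob.Hom.heq_of_toFun (hobj X) (hobj Y) HEq.rfl

theorem scottFunctor_comp_specFunctor :
    scottFunctor hScott hScottMap ⋙ specFunctor hSpec hSpecMap = 𝟭 (CDom.{u, v} L) :=
  have hobj (P : CDom.{u, v} L) :
      (scottFunctor hScott hScottMap ⋙ specFunctor hSpec hSpecMap).obj P = P :=
    CDom.ext rfl (heq_of_eq (P.isContinuous.specOrder_scott P.isContinuous.isT0_scott))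
  Functor.hext hobj fun P Q _ => CDom.Hom.heq_of_toFun (hobj P) (hobj Q) HEq.rfl

end Functors

end LDom

theorem theorem4 (L : Type v) [Order.Frame L] :
    ∃ (hScott : ∀ P : LDom.CDom.{u, v} L,
        P.ord.scott.IsLocallySuperCompact ∧ P.ord.scott.IsSober)
      (hScottMap : ∀ (P Q : LDom.CDom.{u, v} L) (f : P ⟶ Q),
        LDom.IsContinuousMap P.ord.scott Q.ord.scott f.toFun)
      (hSpec : ∀ X : LDom.LSCSob.{u, v} L, X.spec.IsDcpo ∧ X.spec.IsContinuous)
      (hSpecMap : ∀ (X Y : LDom.LSCSob.{u, v} L) (f : X ⟶ Y),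
        LDom.IsScottContinuous X.spec Y.spec f.toFun),
      LDom.specFunctor hSpec hSpecMap ⋙ LDom.scottFunctor hScott hScottMap = 𝟭 (LDom.LSCSob.{u, v} L) ∧
      LDom.scottFunctor hScott hScottMap ⋙ LDom.specFunctor hSpec hSpecMap = 𝟭 (LDom.CDom.{u, v} L) := by
  have hScott (P : LDom.CDom.{u, v} L) :
      P.ord.scott.IsLocallySuperCompact ∧ P.ord.scott.IsSober :=
    ⟨P.isContinuous.isCoreBase_wayBelow.isLocallySuperCompact,
      P.isContinuous.isSober_scott P.isDcpo⟩
  have hSpec (X : LDom.LSCSob.{u, v} L) : X.spec.IsDcpo ∧ X.spec.IsContinuous :=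
    ⟨X.isSober.isDcpo_specOrder, X.isContinuous_spec⟩
  have hScottMap (P Q : LDom.CDom.{u, v} L) (f : P ⟶ Q) :
      LDom.IsContinuousMap P.ord.scott Q.ord.scott f.toFun :=
    f.isScottContinuous.isContinuousMap
  have hSpecMap (X Y : LDom.LSCSob.{u, v} L) (f : X ⟶ Y) :
      LDom.IsScottContinuous X.spec Y.spec f.toFun :=
    LDom.IsContinuousMap.isScottContinuous
      (fun B hB => X.isSober.opens_subset_scott (f.isContinuousMap B hB)) Y.isSober.isT0
  exact ⟨hScott, hScottMap, hSpec, hSpecMap,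
    LDom.specFunctor_comp_scottFunctor hScott hScottMap hSpec hSpecMap,
    LDom.scottFunctor_comp_specFunctor hScott hScottMap hSpec hSpecMap⟩
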